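/- A permutation of length $n\ge 1$ is a word $\pi=\pi_1\cdots\pi_n$ that rearranges $1,\dots,n$; put $|\pi|=n$. For permutations $\pi,\sigma$ of lengths $m,n$, the direct sum $\pi\oplus\sigma$ is $\pi$ followed by $\sigma$ with every entry increased by $m$, and the skew sum $\pi\ominus\sigma$ is $\pi$ with every entry increased by $n$, followed by $\sigma$. A permutation is separable if it can be built from the permutation $1$ by repeatedly applying $\oplus$ and $\ominus$. It is reducible if for some $2\le i\le n$ every element of $\pi_1\cdots\pi_{i-1}$ is less than every element of $\pi_i\cdots\pi_n$, and irreducible otherwise (so the permutation $1$ is irreducible). Let $\mathrm{lmax},\mathrm{rmax},\mathrm{lmin},\mathrm{rmin}$ be the numbers of left-to-right maxima, right-to-left maxima, left-to-right minima and right-to-left minima. Let $S(t,z)=\sum_\pi t^{|\pi|}z^{\mathrm{rmax}(\pi)}$, summed over all separable permutations, and let $I(t,z)$ be the same sum over irreducible separable permutations. Then $S(t,z)$ is unchanged if $\mathrm{rmax}$ is replaced by $\mathrm{lmax}$, $\mathrm{lmin}$ or $\mathrm{rmin}$, and $I(t,z)$ is unchanged if $\mathrm{rmax}$ is replaced by $\mathrm{lmin}$;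 moreover, with $r=\sqrt{t^2-6t+1}$, $$S(t,z)=\frac{4\sqrt{\left(-\tfrac14 r-tz+\tfrac t4+\tfrac54\right)^2+r-t-1}-r+4tz+t-3}{2(r-t-1)},\qquad I(t,z)=\frac{S(t,z)^2}{1+S(t,z)}+tz,$$ where the square roots are the formal power series in $t$ with constant term $1$. **Theorem.** For $(\mathrm{stat}_1,\mathrm{stat}_2)\in\{(\mathrm{rmax},\mathrm{lmin}),(\mathrm{lmax},\mathrm{rmin})\}$, the generating function $\sum_\pi t^{|\pi|}z_1^{\mathrm{stat}_1(\pi)}z_2^{\mathrm{stat}_2(\pi)}$ over all separable permutations is $$F=\frac{S(t,z_1)I(t,z_2)+tz_1z_2}{1-S(t,z_1)I(t,z_2)-tz_1z_2}.$$ For $(\mathrm{rmax},\mathrm{lmin})$, the corresponding generating function over irreducible separable permutations is $F-S(t,z_1)I(t,z_2)$, and over reducible separable permutations it is $S(t,z_1)I(t,z_2)$. For $(\mathrm{lmax},\mathrm{rmin})$, the generating function over irreducible separable permutations is $S(t,z_1)I(t,z_2)+tz_1z_2$, and over reducible separable permutations it is $F-S(t,z_1)I(t,z_2)-tz_1z_2$.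 -/

import Mathlib

open PowerSeries

namespace SepPerm

/-- The permutations of length `n`: the words that are rearrangements of `1, 2, …, n`. -/
def perms (n : ℕ) : Finset (List ℕ) := (List.range' 1 n).permutations.toFinset

/-- The direct sum `π ⊕ σ`. -/
def directSum (π σ : List ℕ) : List ℕ := π ++ σ.map (· + π.length)

/-- The skew sum `π ⊖ σ`. -/
def skewSum (π σ : List ℕ) : List ℕ := π.map (· + σ.length) ++ σ

/-- Separable permutations: those built from the permutation `1` by repeated direct and
skew sums. (The empty permutation is not separable.) -/
inductive IsSeparable : List ℕ → Prop
  | one : IsSeparable [1]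
  | sum {π σ : List ℕ} : IsSeparable π → IsSeparable σ → IsSeparable (directSum π σ)
  | skew {π σ : List ℕ} : IsSeparable π → IsSeparable σ → IsSeparable (skewSum π σ)

/-- `π` can be cut into two nonempty pieces such that every element of the left piece is
less than every element of the right piece. -/
def IsReducible (π : List ℕ) : Prop :=
  ∃ i, 1 ≤ i ∧ i < π.length ∧ ∀ a ∈ π.take i, ∀ b ∈ π.drop i, a < b

/-- Nonempty and not reducible; in particular the permutation `1` is irreducible, and the
empty permutation is neither reducible nor irreducible. -/
def IsIrreducible (π : List ℕ) : Prop := π ≠ [] ∧ ¬ IsReducible π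

/-- Number of left-to-right maxima. -/
def lmax (π : List ℕ) : ℕ :=
  (Finset.univ.filter fun i : Fin π.length => ∀ j : Fin π.length, j < i → π.get j < π.get i).card

/-- Number of right-to-left maxima. -/
def rmax (π : List ℕ) : ℕ :=
  (Finset.univ.filter fun i : Fin π.length => ∀ j : Fin π.length, i < j → π.get j < π.get i).card

/-- Number of left-to-right minima. -/
def lmin (π : List ℕ) : ℕ :=
  (Finset.univ.filter fun i : Fin π.length => ∀ j : Fin π.length, j < i → π.get i < π.get j).card

/-- Number of right-to-left minima. -/
def rmin (π : List ℕ) : ℕ :=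
  (Finset.univ.filter fun i : Fin π.length => ∀ j : Fin π.length, i < j → π.get i < π.get j).card

section GeneratingFunctions

variable {A : Type*} [CommRing A]

open Classical in
/-- The formal power series `∑ t^|π| w(π)` over all permutations `π` with property `P`; the
variable `t` is the power series variable `X`. -/
noncomputable def genFun (P : List ℕ → Prop) (w : List ℕ → A) : A⟦X⟧ :=
  PowerSeries.mk fun n => ∑ π ∈ (perms n).filter P, w π

/-- `∑ t^|π| z^st(π)` over separable permutations. -/
noncomputable def sepGF (st : List ℕ → ℕ) (z : A) : A⟦X⟧ :=
  genFun IsSeparable fun π => z ^ st π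

/-- `∑ t^|π| z^st(π)` over irreducible separable permutations. -/
noncomputable def irrGF (st : List ℕ → ℕ) (z : A) : A⟦X⟧ :=
  genFun (fun π => IsSeparable π ∧ IsIrreducible π) fun π => z ^ st π

/-- The series `S(t,z)`. -/
noncomputable def S (z : A) : A⟦X⟧ := sepGF rmax z

/-- The series `I(t,z)`. -/
noncomputable def I (z : A) : A⟦X⟧ := irrGF rmax z

/-- `∑ t^|π| z₁^st₁(π) z₂^st₂(π)` over separable permutations. -/
noncomputable def sepGF₂ (st₁ st₂ : List ℕ → ℕ) (z₁ z₂ : A) : A⟦X⟧ :=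
  genFun IsSeparable fun π => z₁ ^ st₁ π * z₂ ^ st₂ π

/-- `∑ t^|π| z₁^st₁(π) z₂^st₂(π)` over irreducible separable permutations. -/
noncomputable def irrGF₂ (st₁ st₂ : List ℕ → ℕ) (z₁ z₂ : A) : A⟦X⟧ :=
  genFun (fun π => IsSeparable π ∧ IsIrreducible π) fun π => z₁ ^ st₁ π * z₂ ^ st₂ π

/-- `∑ t^|π| z₁^st₁(π) z₂^st₂(π)` over reducible separable permutations. -/
noncomputable def redGF₂ (st₁ st₂ : List ℕ → ℕ) (z₁ z₂ : A) : A⟦X⟧ :=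
  genFun (fun π => IsSeparable π ∧ IsReducible π) fun π => z₁ ^ st₁ π * z₂ ^ st₂ π

/-- `r = √f` as formal power series: the square root with constant term `1`. -/
def IsSqrt (r f : A⟦X⟧) : Prop := r ^ 2 = f ∧ constantCoeff r = 1

/-- `F = N / D` as formal power series, where `D` is an invertible power series. -/
def IsQuotient (F N D : A⟦X⟧) : Prop := IsUnit D ∧ F * D = N

/-- The closed form of `S(t,z)`:
`S = (4 w - r + 4 t z + t - 3) / (2 (r - t - 1))`, where `r = √(t² - 6 t + 1)` and
`w = √((-r/4 - t z + t/4 + 5/4)² + r - t - 1)`.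
The denominator is nonzero but has no constant term, so the fraction is one in the field of
fractions (`A` being a domain); it is stated here with the denominator cleared. -/
def HasClosedForm [Algebra ℚ A] (S : A⟦X⟧) (z : A) : Prop :=
  ∃ r w : A⟦X⟧, IsSqrt r (X ^ 2 - 6 * X + 1) ∧
    IsSqrt w ((-((1 / 4 : ℚ) • r) - X * C z + (1 / 4 : ℚ) • X + (5 / 4 : ℚ) • 1) ^ 2
      + r - X - 1) ∧
    2 * (r - X - 1) ≠ 0 ∧
    S * (2 * (r - X - 1)) = 4 * w - r + 4 * X * C z + X - 3

end GeneratingFunctions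

/-- The formal variable `z₁`. -/
noncomputable abbrev z₁ : MvPolynomial (Fin 2) ℚ := MvPolynomial.X 0

/-- The formal variable `z₂`. -/
noncomputable abbrev z₂ : MvPolynomial (Fin 2) ℚ := MvPolynomial.X 1

/-- The monomial `t z₁ z₂`. -/
noncomputable abbrev tz₁z₂ : (MvPolynomial (Fin 2) ℚ)⟦X⟧ := X * C z₁ * C z₂

end SepPerm

open SepPerm

/-! Two facts carry everything. A reducible separable permutation is α ⊕ β for exactly one pair with
α irreducible separable and β separable (`IsSeparable.exists_irreducible_directSum`,
`directSum_injective_of_irreducible`). Reversal exchanges ⊕ with ⊖, lmax with rmax and lmin with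
rmin, and it matches the reducible separable permutations with the irreducible ones other than 1
(`isSeparable_and_isIrreducible_iff`).

On α ⊕ β, lmax and rmin are additive, rmax sees only β and lmin only α, so each weight turns the
factorization into a product of series (`redSeries_eq_mul`). With i the series counting irreducible
separable permutations, 2i² - (1+t)i + t = 0, and the series s for lmax or rmin satisfies s = (tz +
i s)(1 + s). This equation has only one power series solution, hence the equidistribution; its
discriminant gives the closed form.

For pairs, the reducible part for (rmax, lmin) is S(t,z₁) I(t,z₂). Reversal gives P = S(t,z₁)
I(t,z₂) + t z₁ z₂ as the irreducible part for (lmax, rmin). Both statistics of that pair are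
additive, so F = P(1 + F), and reversal carries F back to (rmax, lmin). -/

namespace SepPerm

/-! ### Records of a word -/

/-- The number of entries `y` of a word such that `R x y` for every earlier entry `x`. -/
noncomputable def records (R : ℕ → ℕ → Prop) (π : List ℕ) : ℕ :=
  open Classical in
  (Finset.univ.filter fun i : Fin π.length =>
    ∀ j : Fin π.length, j < i → R (π.get j) (π.get i)).card

theorem lmax_eq_records (π : List ℕ) : lmax π = records (· < ·) π := by
  unfold lmax records
  congr

theorem lmin_eq_records (π : List ℕ) : lmin π = records (fun x y => y < x) π := by
  unfold lmin records
  congr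

open Classical in
-- Position i goes to position n - 1 - i. This reduces the right-to-left statistics to the
-- left-to-right ones.
theorem card_later_eq_records_reverse (R : ℕ → ℕ → Prop) (π : List ℕ) :
    (Finset.univ.filter fun i : Fin π.length =>
      ∀ j : Fin π.length, i < j → R (π.get j) (π.get i)).card = records R π.reverse := by
  unfold records
  refine Finset.card_bij' (fun i _ => ⟨π.length - 1 - i, by simp; omega⟩)
    (fun i _ => ⟨π.length - 1 - i, by have := i.2; simp at this; omega⟩) ?_ ?_ ?_ ?_
  · intro i hi
    simp only [Finset.mem_filter, Finset.mem_univ, true_and] at hi ⊢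
    intro j hj
    have hj' := j.2
    simp only [List.length_reverse] at hj'
    have hj'' : (j : ℕ) < π.length - 1 - i := hj
    have h := hi ⟨π.length - 1 - j, by omega⟩ (by
      change (i : ℕ) < π.length - 1 - j
      omega)
    simp only [List.get_eq_getElem, List.getElem_reverse] at h ⊢
    convert h using 2
    have := i.2
    omega
  · intro i hi
    simp only [Finset.mem_filter, Finset.mem_univ, true_and] at hi ⊢
    intro j hj
    have hi' := i.2
    simp only [List.length_reverse] at hi'
    have hj'' : π.length - 1 - i < (j : ℕ) := hj
    have hj' := j.2
    have h := hi ⟨π.length - 1 - j, by simp; omega⟩ (by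
      change π.length - 1 - j < (i : ℕ)
      omega)
    simp only [List.get_eq_getElem, List.getElem_reverse] at h ⊢
    convert h using 2
    omega
  · intro i hi
    ext
    have := i.2
    simp
    omega
  · intro i hi
    ext
    have := i.2
    simp at this ⊢
    omega

theorem rmax_eq_lmax_reverse (π : List ℕ) : rmax π = lmax π.reverse := by
  rw [lmax_eq_records, ← card_later_eq_records_reverse]
  unfold rmax
  congr

theorem rmin_eq_lmin_reverse (π : List ℕ) : rmin π = lmin π.reverse := by
  rw [lmin_eq_records, ← card_later_eq_records_reverse]
  unfold rmin
  congr

theorem lmax_reverse (π : List ℕ) : lmax π.reverse = rmax π := (rmax_eq_lmax_reverse π).symm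

theorem lmin_reverse (π : List ℕ) : lmin π.reverse = rmin π := (rmin_eq_lmin_reverse π).symm

theorem rmax_reverse (π : List ℕ) : rmax π.reverse = lmax π := by
  rw [rmax_eq_lmax_reverse, List.reverse_reverse]

theorem rmin_reverse (π : List ℕ) : rmin π.reverse = lmin π := by
  rw [rmin_eq_lmin_reverse, List.reverse_reverse]

theorem records_nil (R : ℕ → ℕ → Prop) : records R [] = 0 := by
  simp [records]

open Classical in
theorem records_eq_card_range (R : ℕ → ℕ → Prop) (π : List ℕ) :
    records R π = ((Finset.range π.length).filter fun i =>
      ∀ j < i, R (π.getD j 0) (π.getD i 0)).card := by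
  unfold records
  refine Finset.card_bij (fun i _ => (i : ℕ)) ?_ (fun _ _ _ _ h => Fin.ext h) ?_
  · intro i hi
    simp only [Finset.mem_filter, Finset.mem_univ, true_and, Finset.mem_range] at hi ⊢
    refine ⟨i.2, fun j hj => ?_⟩
    have h := hi ⟨j, hj.trans i.2⟩ hj
    rw [List.getD_eq_getElem _ _ (hj.trans i.2), List.getD_eq_getElem _ _ i.2]
    exact h
  · intro i hi
    simp only [Finset.mem_filter, Finset.mem_range] at hi
    refine ⟨⟨i, hi.1⟩, ?_, rfl⟩
    simp only [Finset.mem_filter, Finset.mem_univ, true_and]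
    intro j hj
    have h := hi.2 j hj
    rw [List.getD_eq_getElem _ _ j.2, List.getD_eq_getElem _ _ hi.1] at h
    exact h

open Classical in
theorem records_concat (R : ℕ → ℕ → Prop) (π : List ℕ) (y : ℕ) :
    records R (π ++ [y]) = records R π + if ∀ x ∈ π, R x y then 1 else 0 := by
  rw [records_eq_card_range, records_eq_card_range, List.length_append, List.length_singleton,
    Finset.range_add_one, Finset.filter_insert]
  have hlast : (∀ j < π.length, R ((π ++ [y]).getD j 0) ((π ++ [y]).getD π.length 0)) ↔
      ∀ x ∈ π, R x y := by
    constructor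
    · intro h x hx
      obtain ⟨j, hj, rfl⟩ := List.getElem_of_mem hx
      have := h j hj
      rwa [List.getD_append _ _ _ _ hj, List.getD_append_right _ _ _ _ le_rfl,
        List.getD_eq_getElem _ _ hj, Nat.sub_self] at this
    · intro h j hj
      rw [List.getD_append _ _ _ _ hj, List.getD_append_right _ _ _ _ le_rfl,
        List.getD_eq_getElem _ _ hj, Nat.sub_self]
      exact h _ (List.getElem_mem hj)
  have hfilter : (Finset.range π.length).filter (fun i =>
        ∀ j < i, R ((π ++ [y]).getD j 0) ((π ++ [y]).getD i 0)) =
      (Finset.range π.length).filter fun i => ∀ j < i, R (π.getD j 0) (π.getD i 0) := by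
    refine Finset.filter_congr fun i hi => ?_
    rw [Finset.mem_range] at hi
    refine forall₂_congr fun j hj => ?_
    rw [List.getD_append _ _ _ _ hi, List.getD_append _ _ _ _ (hj.trans hi)]
  rw [hfilter]
  by_cases h : ∀ x ∈ π, R x y
  · rw [if_pos (hlast.2 h), if_pos h, Finset.card_insert_of_notMem (by simp)]
  · rw [if_neg (mt hlast.1 h), if_neg h, add_zero]

theorem records_append_of_forall {R : ℕ → ℕ → Prop} {α β : List ℕ}
    (h : ∀ x ∈ α, ∀ y ∈ β, R x y) : records R (α ++ β) = records R α + records R β := by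
  classical
  induction β using List.reverseRecOn with
  | nil => simp [records_nil]
  | append_singleton β y ih =>
    rw [← List.append_assoc, records_concat, records_concat,
      ih fun x hx z hz => h x hx z (by simp [hz]), add_assoc]
    congr 2
    refine if_congr ?_ rfl rfl
    have := fun x hx => h x hx y (by simp)
    simp only [List.mem_append]
    exact ⟨fun H x hx => H x (Or.inr hx), fun H x hx => hx.elim (this x) (H x)⟩

/-- Any one entry of α prevents every entry of β from being a record, so α must be nonempty. -/
theorem records_append_of_forall_not {R : ℕ → ℕ → Prop} {α β : List ℕ} (hα : α ≠ [])
    (h : ∀ x ∈ α, ∀ y ∈ β, ¬ R x y) : records R (α ++ β) = records R α := by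
  classical
  induction β using List.reverseRecOn with
  | nil => simp
  | append_singleton β y ih =>
    rw [← List.append_assoc, records_concat, ih fun x hx z hz => h x hx z (by simp [hz]),
      if_neg, add_zero]
    obtain ⟨x, hx⟩ := List.exists_mem_of_ne_nil α hα
    exact fun H => h x hx y (by simp) (H x (by simp [hx]))

theorem records_map {R : ℕ → ℕ → Prop} {f : ℕ → ℕ} (hf : ∀ x y, R (f x) (f y) ↔ R x y)
    (π : List ℕ) : records R (π.map f) = records R π := by
  classical
  induction π using List.reverseRecOn with
  | nil => rfl
  | append_singleton π y ih =>
    rw [List.map_append, List.map_singleton, records_concat, records_concat, ih]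
    simp [hf]

/-! ### Permutations, direct sums and reversal -/

theorem mem_perms {n : ℕ} {π : List ℕ} : π ∈ perms n ↔ π.Perm (List.range' 1 n) := by
  simp [perms]

theorem length_of_mem_perms {n : ℕ} {π : List ℕ} (h : π ∈ perms n) : π.length = n := by
  simpa using (mem_perms.1 h).length_eq

theorem reverse_mem_perms {n : ℕ} {π : List ℕ} : π.reverse ∈ perms n ↔ π ∈ perms n := by
  rw [mem_perms, mem_perms]
  exact ⟨(List.reverse_perm π).symm.trans, (List.reverse_perm π).trans⟩

theorem directSum_mem_perms {m n : ℕ} {α β : List ℕ} (hα : α ∈ perms m) (hβ : β ∈ perms n) :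
    directSum α β ∈ perms (m + n) := by
  have hl := length_of_mem_perms hα
  rw [mem_perms] at *
  have h : List.range' 1 (m + n) = List.range' 1 m ++ (List.range' 1 n).map (· + m) := by
    rw [← List.range'_append_1]
    congr 1
    rw [show (fun x : ℕ => x + m) = (m + ·) by funext x; exact add_comm x m,
      List.map_add_range', add_comm]
  rw [h, directSum, hl]
  exact hα.append (hβ.map _)

theorem reverse_directSum (α β : List ℕ) :
    (directSum α β).reverse = skewSum β.reverse α.reverse := by
  simp [directSum, skewSum]

theorem reverse_skewSum (α β : List ℕ) :
    (skewSum α β).reverse = directSum β.reverse α.reverse := by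
  simp [directSum, skewSum]

theorem IsSeparable.reverse {π : List ℕ} (h : IsSeparable π) : IsSeparable π.reverse := by
  induction h with
  | one => exact .one
  | sum _ _ hα hβ => rw [reverse_directSum]; exact .skew hβ hα
  | skew _ _ hα hβ => rw [reverse_skewSum]; exact .sum hβ hα

theorem isSeparable_reverse {π : List ℕ} : IsSeparable π.reverse ↔ IsSeparable π :=
  ⟨fun h => by simpa using h.reverse, IsSeparable.reverse⟩

theorem length_directSum (α β : List ℕ) : (directSum α β).length = α.length + β.length := by
  simp [directSum]

theorem length_skewSum (α β : List ℕ) : (skewSum α β).length = α.length + β.length := by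
  simp [skewSum]

theorem IsSeparable.mem_perms {π : List ℕ} (h : IsSeparable π) : π ∈ perms π.length := by
  induction h with
  | one => rw [SepPerm.mem_perms]; rfl
  | sum _ _ hα hβ => rw [length_directSum]; exact directSum_mem_perms hα hβ
  | @skew α β _ _ hα hβ =>
    rw [← reverse_mem_perms, reverse_skewSum, length_skewSum, add_comm]
    exact directSum_mem_perms (reverse_mem_perms.2 hβ) (reverse_mem_perms.2 hα)

theorem IsSeparable.ne_nil {π : List ℕ} (h : IsSeparable π) : π ≠ [] := by
  induction h with
  | one => simp
  | sum _ _ hα _ => simp [directSum, hα]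
  | skew _ _ hα _ => simp [skewSum, hα]

theorem lt_of_mem_of_mem_map_add {n : ℕ} {α β : List ℕ} (hα : α ∈ perms α.length)
    (hβ : β ∈ perms n) : ∀ x ∈ α, ∀ y ∈ β.map (· + α.length), x < y := by
  intro x hx y hy
  obtain ⟨b, hb, rfl⟩ := List.mem_map.1 hy
  have h1 := (mem_perms.1 hα).mem_iff.1 hx
  have h2 := (mem_perms.1 hβ).mem_iff.1 hb
  simp only [List.mem_range'_1] at h1 h2
  omega

section Statistics

variable {α β : List ℕ}

theorem lmax_directSum (hα : IsSeparable α) (hβ : IsSeparable β) :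
    lmax (directSum α β) = lmax α + lmax β := by
  rw [lmax_eq_records, lmax_eq_records, lmax_eq_records, directSum,
    records_append_of_forall (lt_of_mem_of_mem_map_add hα.mem_perms hβ.mem_perms),
    records_map (by simp)]

theorem lmin_directSum (hα : IsSeparable α) (hβ : IsSeparable β) :
    lmin (directSum α β) = lmin α := by
  rw [lmin_eq_records, lmin_eq_records, directSum, records_append_of_forall_not hα.ne_nil]
  exact fun x hx y hy =>
    (lt_of_mem_of_mem_map_add hα.mem_perms hβ.mem_perms x hx y hy).not_gt

theorem rmax_directSum (hα : IsSeparable α) (hβ : IsSeparable β) :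
    rmax (directSum α β) = rmax β := by
  rw [rmax_eq_lmax_reverse, rmax_eq_lmax_reverse, lmax_eq_records, lmax_eq_records, directSum,
    List.reverse_append, records_append_of_forall_not, ← List.map_reverse, records_map (by simp)]
  · simpa using hβ.ne_nil
  · simp only [List.mem_reverse]
    exact fun y hy x hx =>
      (lt_of_mem_of_mem_map_add hα.mem_perms hβ.mem_perms x hx y hy).not_gt

theorem rmin_directSum (hα : IsSeparable α) (hβ : IsSeparable β) :
    rmin (directSum α β) = rmin α + rmin β := by
  rw [rmin_eq_lmin_reverse, rmin_eq_lmin_reverse, rmin_eq_lmin_reverse, lmin_eq_records,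
    lmin_eq_records, lmin_eq_records, directSum, List.reverse_append, records_append_of_forall,
    ← List.map_reverse, records_map (by simp), add_comm]
  simp only [List.mem_reverse]
  exact fun y hy x hx => lt_of_mem_of_mem_map_add hα.mem_perms hβ.mem_perms x hx y hy

end Statistics

theorem lmax_singleton (x : ℕ) : lmax [x] = 1 := by
  simpa [lmax_eq_records, records_nil] using records_concat (· < ·) [] x

theorem lmin_singleton (x : ℕ) : lmin [x] = 1 := by
  simpa [lmin_eq_records, records_nil] using records_concat (fun a b => b < a) [] x

theorem rmax_singleton (x : ℕ) : rmax [x] = 1 := by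
  simp [rmax_eq_lmax_reverse, lmax_singleton]

theorem rmin_singleton (x : ℕ) : rmin [x] = 1 := by
  simp [rmin_eq_lmin_reverse, lmin_singleton]

/-! ### Reducible separable permutations -/

theorem isReducible_iff_exists_append {π : List ℕ} : IsReducible π ↔
    ∃ α β, α ≠ [] ∧ β ≠ [] ∧ π = α ++ β ∧ ∀ a ∈ α, ∀ b ∈ β, a < b := by
  constructor
  · rintro ⟨i, hi, hi', h⟩
    refine ⟨π.take i, π.drop i, ?_, ?_, (List.take_append_drop i π).symm, h⟩
    · exact List.ne_nil_of_length_pos (by simp; omega)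
    · exact List.ne_nil_of_length_pos (by simp; omega)
  · rintro ⟨α, β, hα, hβ, rfl, h⟩
    have h1 := List.length_pos_iff.2 hα
    have h2 := List.length_pos_iff.2 hβ
    exact ⟨α.length, h1, by simp; omega, by simpa using h⟩

theorem not_isReducible_singleton (x : ℕ) : ¬ IsReducible [x] := by
  rintro ⟨i, hi, hi', -⟩
  simp only [List.length_singleton] at hi'
  omega

theorem IsReducible.head_lt_getLast {π : List ℕ} (h : IsReducible π) (hπ : π ≠ []) :
    π.head hπ < π.getLast hπ := by
  obtain ⟨α, β, hα, hβ, rfl, hlt⟩ := isReducible_iff_exists_append.1 h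
  rw [List.head_append_of_ne_nil hα, List.getLast_append_of_ne_nil _ hβ]
  exact hlt _ (List.head_mem hα) _ (List.getLast_mem hβ)

/-- Reducibility forces the first entry below the last, and reversal swaps these two entries. -/
theorem IsReducible.not_reverse {π : List ℕ} (h : IsReducible π) : ¬ IsReducible π.reverse := by
  intro h'
  have hπ : π ≠ [] := by
    rintro rfl
    obtain ⟨i, hi, hi', -⟩ := h
    simp at hi'
  have h1 := h.head_lt_getLast hπ
  have h2 := h'.head_lt_getLast (by simpa using hπ)
  rw [List.head_reverse, List.getLast_reverse] at h2
  omega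

theorem isReducible_directSum {α β : List ℕ} (hα : IsSeparable α) (hβ : IsSeparable β) :
    IsReducible (directSum α β) :=
  isReducible_iff_exists_append.2 ⟨_, _, hα.ne_nil, by simpa using hβ.ne_nil, rfl,
    lt_of_mem_of_mem_map_add hα.mem_perms hβ.mem_perms⟩

theorem isReducible_reverse_skewSum {α β : List ℕ} (hα : IsSeparable α) (hβ : IsSeparable β) :
    IsReducible (skewSum α β).reverse := by
  rw [reverse_skewSum]
  exact isReducible_directSum hβ.reverse hα.reverse

/-- The last construction step decides: a direct sum is reducible, while a skew sum becomes a direct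
sum on reversal. -/
theorem isSeparable_and_isIrreducible_iff {π : List ℕ} :
    IsSeparable π ∧ IsIrreducible π ↔ π = [1] ∨ IsSeparable π ∧ IsReducible π.reverse := by
  constructor
  · rintro ⟨h, -, hi⟩
    cases h with
    | one => exact Or.inl rfl
    | sum hα hβ => exact absurd (isReducible_directSum hα hβ) hi
    | skew hα hβ => exact Or.inr ⟨.skew hα hβ, isReducible_reverse_skewSum hα hβ⟩
  · rintro (rfl | ⟨h, hr⟩)
    · exact ⟨.one, by simp, not_isReducible_singleton 1⟩
    · exact ⟨h, h.ne_nil, fun h' => h'.not_reverse hr⟩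

theorem directSum_assoc (α β γ : List ℕ) :
    directSum (directSum α β) γ = directSum α (directSum β γ) := by
  simp [directSum, Function.comp_def, add_assoc, add_comm α.length]

/-- If the left summand is still reducible, split it inductively and move the remainder to the right
by associativity of ⊕. -/
theorem IsSeparable.exists_irreducible_directSum {π : List ℕ} (h : IsSeparable π)
    (hr : IsReducible π) : ∃ α β, IsSeparable α ∧ IsIrreducible α ∧ IsSeparable β ∧
      directSum α β = π := by
  induction h with
  | one => exact absurd hr (not_isReducible_singleton 1)
  | @sum α β hα hβ ih _ =>
    by_cases h : IsReducible α
    · obtain ⟨γ, δ, hγ, hγ', hδ, rfl⟩ := ih h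
      exact ⟨γ, directSum δ β, hγ, hγ', .sum hδ hβ, (directSum_assoc γ δ β).symm⟩
    · exact ⟨α, β, hα, ⟨hα.ne_nil, h⟩, hβ, rfl⟩
  | skew hα hβ => exact absurd (isReducible_reverse_skewSum hα hβ) hr.not_reverse

/-- If α' were longer than α, then α would be a proper prefix of α' with every later entry of α'
coming from the shifted β, so α' would be reducible. Applied both ways, this gives uniqueness of the
factorization. -/
theorem length_le_of_directSum_eq {α β α' β' : List ℕ} (hα : IsSeparable α)
    (hα' : IsIrreducible α') (hβ : IsSeparable β)
    (h : directSum α β = directSum α' β') : α'.length ≤ α.length := by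
  by_contra! hlt
  refine hα'.2 ⟨α.length, List.length_pos_iff.2 hα.ne_nil, hlt, ?_⟩
  have hpre : α' = (directSum α β).take α'.length := by rw [h, directSum, List.take_left]
  have h1 : α'.take α.length = α := by
    rw [hpre, List.take_take, min_eq_left hlt.le, directSum, List.take_left]
  have h2 : α'.drop α.length = (β.map (· + α.length)).take (α'.length - α.length) := by
    conv_lhs => rw [hpre]
    rw [List.drop_take, directSum, List.drop_left]
  rw [h1, h2]
  exact fun a ha b hb =>
    lt_of_mem_of_mem_map_add hα.mem_perms hβ.mem_perms a ha b (List.mem_of_mem_take hb)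

theorem directSum_injective_of_irreducible {α β α' β' : List ℕ} (hα : IsSeparable α)
    (hα₁ : IsIrreducible α) (hβ : IsSeparable β) (hα' : IsSeparable α')
    (hα₁' : IsIrreducible α') (hβ' : IsSeparable β')
    (h : directSum α β = directSum α' β') : α = α' ∧ β = β' := by
  have hl : α.length = α'.length :=
    le_antisymm (length_le_of_directSum_eq hα' hα₁ hβ' h.symm)
      (length_le_of_directSum_eq hα hα₁' hβ h)
  obtain ⟨h1, h2⟩ := List.append_inj h hl
  rw [hl] at h2
  exact ⟨h1, List.map_injective_iff.2 (add_left_injective _) h2⟩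

/-! ### Generating functions -/

section GeneratingFunctions

variable {A : Type*} [CommRing A]

theorem genFun_reverse (P : List ℕ → Prop) (w : List ℕ → A) :
    genFun (fun π => P π.reverse) (fun π => w π.reverse) = genFun P w := by
  classical
  ext n
  simp only [genFun, coeff_mk]
  refine Finset.sum_bij' (fun π _ => π.reverse) (fun π _ => π.reverse) ?_ ?_ ?_ ?_ ?_ <;>
    simp +contextual [reverse_mem_perms]

theorem coeff_genFun (P : List ℕ → Prop) [DecidablePred P] (w : List ℕ → A) (n : ℕ) :
    coeff n (genFun P w) = ∑ π ∈ (perms n).filter P, w π := by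
  rw [genFun, coeff_mk]
  congr

theorem genFun_or {P Q : List ℕ → Prop} (w : List ℕ → A) (h : ∀ π, P π → ¬ Q π) :
    genFun (fun π => P π ∨ Q π) w = genFun P w + genFun Q w := by
  classical
  ext n
  rw [map_add, coeff_genFun, coeff_genFun, coeff_genFun]
  rw [Finset.filter_or, Finset.sum_union]
  exact Finset.disjoint_filter.2 fun π _ => h π

theorem genFun_congr {P Q : List ℕ → Prop} (w : List ℕ → A) (h : ∀ π, P π ↔ Q π) :
    genFun P w = genFun Q w := by
  rw [funext fun π => propext (h π)]

theorem genFun_eq_singleton_one (w : List ℕ → A) :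
    genFun (fun π => π = [1]) w = X * C (w [1]) := by
  classical
  ext n
  rw [coeff_genFun, coeff_mul_C, coeff_X]
  have hmem : [1] ∈ perms n ↔ n = 1 := by
    refine ⟨fun h => (length_of_mem_perms h).symm, ?_⟩
    rintro rfl
    exact IsSeparable.one.mem_perms
  rw [Finset.filter_eq']
  by_cases hn : n = 1
  · subst hn
    simp [hmem]
  · simp [hmem, hn]

/-- `∑ t^|π| w(π)` over separable permutations. -/
noncomputable def sepSeries (w : List ℕ → A) : A⟦X⟧ := genFun IsSeparable w

/-- `∑ t^|π| w(π)` over irreducible separable permutations. -/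
noncomputable def irrSeries (w : List ℕ → A) : A⟦X⟧ :=
  genFun (fun π => IsSeparable π ∧ IsIrreducible π) w

/-- `∑ t^|π| w(π)` over reducible separable permutations. -/
noncomputable def redSeries (w : List ℕ → A) : A⟦X⟧ :=
  genFun (fun π => IsSeparable π ∧ IsReducible π) w

theorem sepSeries_eq_add (w : List ℕ → A) : sepSeries w = irrSeries w + redSeries w := by
  unfold sepSeries irrSeries redSeries
  rw [← genFun_or w fun π h h' => h.2.2 h'.2]
  refine genFun_congr w fun π => ?_
  constructor
  · intro h
    by_cases hr : IsReducible π
    · exact Or.inr ⟨h, hr⟩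
    · exact Or.inl ⟨h, h.ne_nil, hr⟩
  · rintro (h | h) <;> exact h.1

theorem sepSeries_reverse (w : List ℕ → A) :
    sepSeries (fun π => w π.reverse) = sepSeries w := by
  unfold sepSeries
  rw [← genFun_reverse IsSeparable w]
  exact genFun_congr _ fun π => isSeparable_reverse.symm

/-- An irreducible separable permutation is 1 or the reverse of a reducible one. -/
theorem irrSeries_eq_add (w : List ℕ → A) :
    irrSeries w = X * C (w [1]) + redSeries fun π => w π.reverse := by
  have h : redSeries (fun π => w π.reverse) =
      genFun (fun π => IsSeparable π ∧ IsReducible π.reverse) w := by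
    unfold redSeries
    rw [← genFun_reverse _ w]
    exact genFun_congr _ fun π => by rw [isSeparable_reverse, List.reverse_reverse]
  rw [h, ← genFun_eq_singleton_one, ← genFun_or w, irrSeries]
  · exact genFun_congr _ fun π => isSeparable_and_isIrreducible_iff
  · rintro π rfl ⟨-, h⟩
    exact not_isReducible_singleton 1 h

/-- The unique factorization is a length-preserving bijection from pairs (α, β) onto reducible
separable permutations; the weight only has to be multiplicative along it. -/
theorem redSeries_eq_mul {w w₁ w₂ : List ℕ → A}
    (h : ∀ α β, IsSeparable α → IsSeparable β → w (directSum α β) = w₁ α * w₂ β) :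
    redSeries w = irrSeries w₁ * sepSeries w₂ := by
  classical
  ext n
  simp only [redSeries, irrSeries, sepSeries, genFun, coeff_mul, coeff_mk,
    Finset.sum_mul_sum, ← Finset.sum_product']
  rw [Finset.sum_sigma']
  symm
  refine Finset.sum_bij (fun x _ => directSum x.2.1 x.2.2) ?_ ?_ ?_ ?_
  · rintro ⟨⟨k, l⟩, α, β⟩ hx
    simp only [Finset.mem_sigma, Finset.HasAntidiagonal.mem_antidiagonal, Finset.mem_product,
      Finset.mem_filter] at hx ⊢
    obtain ⟨rfl, ⟨hα, hα', -⟩, hβ, hβ'⟩ := hx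
    exact ⟨directSum_mem_perms hα hβ, .sum hα' hβ', isReducible_directSum hα' hβ'⟩
  · rintro ⟨⟨k, l⟩, α, β⟩ hx ⟨⟨k', l'⟩, α', β'⟩ hx' heq
    simp only [Finset.mem_sigma, Finset.HasAntidiagonal.mem_antidiagonal, Finset.mem_product,
      Finset.mem_filter] at hx hx' heq
    obtain ⟨-, ⟨hα, hα₁, hα₂⟩, hβ, hβ₁⟩ := hx
    obtain ⟨-, ⟨hα', hα₁', hα₂'⟩, hβ', hβ₁'⟩ := hx'
    obtain ⟨rfl, rfl⟩ :=
      directSum_injective_of_irreducible hα₁ hα₂ hβ₁ hα₁' hα₂' hβ₁' heq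
    rw [← length_of_mem_perms hα, ← length_of_mem_perms hβ, ← length_of_mem_perms hα',
      ← length_of_mem_perms hβ']
  · intro π hπ
    simp only [Finset.mem_filter] at hπ
    obtain ⟨hπ, hs, hr⟩ := hπ
    obtain ⟨α, β, hα, hα', hβ, rfl⟩ := hs.exists_irreducible_directSum hr
    refine ⟨⟨(α.length, β.length), α, β⟩, ?_, rfl⟩
    simp only [Finset.mem_sigma, Finset.HasAntidiagonal.mem_antidiagonal, Finset.mem_product,
      Finset.mem_filter]
    exact ⟨(length_directSum α β).symm.trans (length_of_mem_perms hπ),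
      ⟨hα.mem_perms, hα, hα'⟩, hβ.mem_perms, hβ⟩
  · rintro ⟨⟨k, l⟩, α, β⟩ hx
    simp only [Finset.mem_sigma, Finset.mem_product, Finset.mem_filter] at hx
    exact (h α β hx.2.1.2.1 hx.2.2.2).symm

theorem constantCoeff_genFun (P : List ℕ → Prop) (w : List ℕ → A) (hP : ¬ P []) :
    constantCoeff (genFun P w) = 0 := by
  classical
  rw [← coeff_zero_eq_constantCoeff_apply, coeff_genFun]
  refine Finset.sum_eq_zero fun π hπ => ?_
  rw [Finset.mem_filter] at hπ
  have := List.length_eq_zero_iff.1 (length_of_mem_perms hπ.1)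
  subst this
  exact absurd hπ.2 hP

theorem constantCoeff_sepSeries (w : List ℕ → A) : constantCoeff (sepSeries w) = 0 :=
  constantCoeff_genFun _ _ fun h => h.ne_nil rfl

theorem constantCoeff_irrSeries (w : List ℕ → A) : constantCoeff (irrSeries w) = 0 :=
  constantCoeff_genFun _ _ fun h => h.2.1 rfl

theorem isUnit_of_constantCoeff_eq_one {f : A⟦X⟧} (h : constantCoeff f = 1) : IsUnit f :=
  isUnit_iff_constantCoeff.2 (h ▸ isUnit_one)

/-! ### The functional equations -/

theorem redSeries_one :
    redSeries (fun _ => (1 : A)) = irrSeries (fun _ => (1 : A)) * sepSeries fun _ => (1 : A) :=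
  redSeries_eq_mul fun _ _ _ _ => (one_mul 1).symm

theorem irrSeries_one :
    irrSeries (fun _ => (1 : A)) = X + redSeries fun _ => (1 : A) := by
  simpa using irrSeries_eq_add fun _ => (1 : A)

theorem sepSeries_one :
    sepSeries (fun _ => (1 : A)) =
      irrSeries (fun _ => (1 : A)) * (1 + sepSeries fun _ => (1 : A)) := by
  rw [mul_one_add, ← redSeries_one]
  exact sepSeries_eq_add _

/-- The quadratic equation of the series counting irreducible separable permutations. -/
theorem irrSeries_one_quadratic :
    2 * irrSeries (fun _ => (1 : A)) ^ 2 - (1 + X) * irrSeries (fun _ => (1 : A)) + X = 0 := by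
  have h1 := sepSeries_one (A := A)
  have h2 := irrSeries_one (A := A)
  rw [redSeries_one] at h2
  set s := sepSeries fun _ => (1 : A)
  set i := irrSeries fun _ => (1 : A)
  linear_combination (i - 1) * h2 - i * h1

variable (z : A)

theorem redSeries_lmax : redSeries (fun π => z ^ lmax π) =
    irrSeries (fun π => z ^ lmax π) * sepSeries fun π => z ^ lmax π :=
  redSeries_eq_mul fun α β hα hβ => by rw [lmax_directSum hα hβ, pow_add]

theorem redSeries_rmin : redSeries (fun π => z ^ rmin π) =
    irrSeries (fun π => z ^ rmin π) * sepSeries fun π => z ^ rmin π :=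
  redSeries_eq_mul fun α β hα hβ => by rw [rmin_directSum hα hβ, pow_add]

theorem redSeries_rmax : redSeries (fun π => z ^ rmax π) =
    irrSeries (fun _ => 1) * sepSeries fun π => z ^ rmax π :=
  redSeries_eq_mul fun α β hα hβ => by rw [rmax_directSum hα hβ, one_mul]

/-- Since lmin sees only α, the factorization gives J s₁, with J the irreducible lmin series and s₁
the plain count of separable permutations. As s₁ = i(1 + s₁) and the full lmin series is J(1 + s₁),
this equals i times the full series, the same shape as for rmax. -/
theorem redSeries_lmin : redSeries (fun π => z ^ lmin π) =
    irrSeries (fun _ => 1) * sepSeries fun π => z ^ lmin π := by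
  have h : redSeries (fun π => z ^ lmin π) =
      irrSeries (fun π => z ^ lmin π) * sepSeries fun _ => 1 :=
    redSeries_eq_mul fun α β hα hβ => by rw [lmin_directSum hα hβ, mul_one]
  linear_combination (1 - irrSeries (fun _ => (1 : A))) * h
    + irrSeries (fun π => z ^ lmin π) * sepSeries_one (A := A)
    - irrSeries (fun _ => (1 : A)) * sepSeries_eq_add fun π => z ^ lmin π

theorem sepSeries_rmax : sepSeries (fun π => z ^ rmax π) = sepSeries fun π => z ^ lmax π := by
  simpa only [lmax_reverse] using sepSeries_reverse fun π => z ^ lmax π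

theorem sepSeries_lmin : sepSeries (fun π => z ^ lmin π) = sepSeries fun π => z ^ rmin π := by
  simpa only [rmin_reverse] using sepSeries_reverse fun π => z ^ rmin π

theorem irrSeries_lmax : irrSeries (fun π => z ^ lmax π) =
    X * C z + irrSeries (fun _ => 1) * sepSeries fun π => z ^ rmax π := by
  simpa only [lmax_reverse, lmax_singleton, pow_one, redSeries_rmax] using
    irrSeries_eq_add fun π => z ^ lmax π

theorem irrSeries_rmin : irrSeries (fun π => z ^ rmin π) =
    X * C z + irrSeries (fun _ => 1) * sepSeries fun π => z ^ lmin π := by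
  simpa only [rmin_reverse, rmin_singleton, pow_one, redSeries_lmin] using
    irrSeries_eq_add fun π => z ^ rmin π

theorem irrSeries_rmax : irrSeries (fun π => z ^ rmax π) =
    X * C z + irrSeries (fun π => z ^ lmax π) * sepSeries fun π => z ^ lmax π := by
  simpa only [rmax_reverse, rmax_singleton, pow_one, redSeries_lmax] using
    irrSeries_eq_add fun π => z ^ rmax π

theorem irrSeries_lmin : irrSeries (fun π => z ^ lmin π) =
    X * C z + irrSeries (fun π => z ^ rmin π) * sepSeries fun π => z ^ rmin π := by
  simpa only [lmin_reverse, lmin_singleton, pow_one, redSeries_rmin] using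
    irrSeries_eq_add fun π => z ^ lmin π

theorem sepSeries_lmax_equation : sepSeries (fun π => z ^ lmax π) =
    (X * C z + irrSeries (fun _ => 1) * sepSeries fun π => z ^ lmax π) *
      (1 + sepSeries fun π => z ^ lmax π) := by
  have h := sepSeries_eq_add fun π => z ^ lmax π
  rwa [redSeries_lmax, ← mul_one_add, irrSeries_lmax, sepSeries_rmax] at h

theorem sepSeries_rmin_equation : sepSeries (fun π => z ^ rmin π) =
    (X * C z + irrSeries (fun _ => 1) * sepSeries fun π => z ^ rmin π) *
      (1 + sepSeries fun π => z ^ rmin π) := by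
  have h := sepSeries_eq_add fun π => z ^ rmin π
  rwa [redSeries_rmin, ← mul_one_add, irrSeries_rmin, sepSeries_lmin] at h

/-- Subtracting the two equations leaves s - s' times a series with constant term 1, which is a
unit. -/
theorem eq_of_quadratic_equation {i s s' : A⟦X⟧} (hi : constantCoeff i = 0)
    (h : s = (X * C z + i * s) * (1 + s)) (h' : s' = (X * C z + i * s') * (1 + s')) :
    s = s' := by
  have hu : IsUnit (1 - X * C z - i - i * (s + s')) :=
    isUnit_of_constantCoeff_eq_one (by simp [hi])
  have : (1 - X * C z - i - i * (s + s')) * (s - s') = 0 := by linear_combination h - h'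
  exact sub_eq_zero.1 ((hu.mul_right_eq_zero).1 this)

theorem sepSeries_rmin_eq_lmax :
    sepSeries (fun π => z ^ rmin π) = sepSeries fun π => z ^ lmax π :=
  eq_of_quadratic_equation z (constantCoeff_irrSeries _) (sepSeries_rmin_equation z)
    (sepSeries_lmax_equation z)

theorem irrSeries_lmin_eq_rmax :
    irrSeries (fun π => z ^ lmin π) = irrSeries fun π => z ^ rmax π := by
  rw [irrSeries_lmin, irrSeries_rmax, irrSeries_rmin, irrSeries_lmax, sepSeries_lmin,
    sepSeries_rmax, sepSeries_rmin_eq_lmax]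

theorem S_eq_sepSeries_lmax : S z = sepSeries fun π => z ^ lmax π := sepSeries_rmax z

theorem isQuotient_I_sub :
    IsQuotient (I z - X * C z) (S z ^ 2) (1 + S z) := by
  refine ⟨isUnit_of_constantCoeff_eq_one ?_, ?_⟩
  · rw [S_eq_sepSeries_lmax]
    simp [constantCoeff_sepSeries]
  · have h1 : I z = _ := irrSeries_rmax z
    have h2 := sepSeries_lmax_equation z
    rw [irrSeries_lmax, sepSeries_rmax] at h1
    rw [h1, S_eq_sepSeries_lmax]
    linear_combination (-sepSeries fun π => z ^ lmax π) * h2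

theorem hasClosedForm_S [Algebra ℚ A] [Nontrivial A] : HasClosedForm (S z) z := by
  rw [S_eq_sepSeries_lmax]
  have hS := sepSeries_lmax_equation z
  have hI := irrSeries_one_quadratic (A := A)
  have hs0 := constantCoeff_sepSeries fun π => z ^ lmax π
  have hi0 := constantCoeff_irrSeries fun _ => (1 : A)
  set s := sepSeries fun π => z ^ lmax π
  set i := irrSeries fun _ => (1 : A)
  have h4 : (4 : A⟦X⟧) * algebraMap ℚ A⟦X⟧ (1 / 4) = 1 := by
    rw [← map_ofNat (algebraMap ℚ A⟦X⟧) 4, ← map_mul]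
    norm_num
  have h54 : algebraMap ℚ A⟦X⟧ (5 / 4) = 5 * algebraMap ℚ A⟦X⟧ (1 / 4) := by
    rw [← map_ofNat (algebraMap ℚ A⟦X⟧) 5, ← map_mul]
    norm_num
  -- Both roots come from completing the square: r in the quadratic for i, and w in i s² + (tz + i -
  -- 1)s + tz = 0. In particular r - t - 1 = -4i.
  refine ⟨1 + X - 4 * i, 1 - X * C z - i - 2 * i * s, ⟨?_, by simp [hi0]⟩,
    ⟨?_, by simp [hi0]⟩, ?_, ?_⟩
  · linear_combination 8 * hI
  · simp only [Algebra.smul_def, h54]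
    set q := algebraMap ℚ A⟦X⟧ (1 / 4)
    have hbase : -(q * (1 + X - 4 * i)) - X * C z + q * X + 5 * q * 1 = i + 1 - X * C z := by
      linear_combination (i + 1) * h4
    rw [hbase]
    linear_combination (-4 * i) * hS
  -- The denominator is -8i; if it vanished then i = 0, and the quadratic for i would give t = 0.
  · intro h
    have h8 : (8 : A⟦X⟧) * algebraMap ℚ A⟦X⟧ (1 / 8) = 1 := by
      rw [← map_ofNat (algebraMap ℚ A⟦X⟧) 8, ← map_mul]
      norm_num
    have hi : i = 0 := by
      linear_combination (-algebraMap ℚ A⟦X⟧ (1 / 8)) * h - i * h8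
    rw [hi] at hI
    exact X_ne_zero (R := A) (by linear_combination hI)
  · ring

/-! ### Pairs of statistics -/

variable (y : A)

theorem redSeries_rmax_lmin : redSeries (fun π => y ^ rmax π * z ^ lmin π) = S y * I z := by
  have h : redSeries (fun π => y ^ rmax π * z ^ lmin π) =
      irrSeries (fun π => z ^ lmin π) * sepSeries fun π => y ^ rmax π :=
    redSeries_eq_mul fun α β hα hβ => by
      rw [rmax_directSum hα hβ, lmin_directSum hα hβ, mul_comm]
  rw [h, irrSeries_lmin_eq_rmax, mul_comm]
  rfl

theorem irrSeries_lmax_rmin :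
    irrSeries (fun π => y ^ lmax π * z ^ rmin π) = S y * I z + X * C y * C z := by
  have h := irrSeries_eq_add fun π => y ^ lmax π * z ^ rmin π
  simp only [lmax_reverse, rmin_reverse, lmax_singleton, rmin_singleton, pow_one,
    redSeries_rmax_lmin, map_mul] at h
  rw [h]
  ring

theorem redSeries_lmax_rmin : redSeries (fun π => y ^ lmax π * z ^ rmin π) =
    irrSeries (fun π => y ^ lmax π * z ^ rmin π) *
      sepSeries fun π => y ^ lmax π * z ^ rmin π :=
  redSeries_eq_mul fun α β hα hβ => by
    rw [lmax_directSum hα hβ, rmin_directSum hα hβ, pow_add, pow_add]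
    ring

theorem sepSeries_rmax_lmin : sepSeries (fun π => y ^ rmax π * z ^ lmin π) =
    sepSeries fun π => y ^ lmax π * z ^ rmin π := by
  simpa only [lmax_reverse, rmin_reverse] using
    sepSeries_reverse fun π => y ^ lmax π * z ^ rmin π

theorem isQuotient_sepSeries_lmax_rmin :
    IsQuotient (sepSeries fun π => y ^ lmax π * z ^ rmin π)
      (S y * I z + X * C y * C z) (1 - S y * I z - X * C y * C z) := by
  refine ⟨isUnit_of_constantCoeff_eq_one ?_, ?_⟩
  · have h : constantCoeff (S y) = 0 := constantCoeff_sepSeries _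
    simp [h]
  · have h := sepSeries_eq_add fun π => y ^ lmax π * z ^ rmin π
    rw [redSeries_lmax_rmin, irrSeries_lmax_rmin] at h
    linear_combination h

end GeneratingFunctions

end SepPerm

theorem theorem5 :
    -- `S(t,z)` is the same series for all four statistics and has the explicit closed form;
    -- `I(t,z)` is the same series for `rmax` and `lmin` and equals `S²/(1+S) + t z`
    (∀ z ∈ ({z₁, z₂} : Set (MvPolynomial (Fin 2) ℚ)),
      sepGF lmax z = S z ∧
      sepGF rmax z = S z ∧
      sepGF lmin z = S z ∧
      sepGF rmin z = S z ∧
      HasClosedForm (S z) z ∧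
      irrGF rmax z = I z ∧
      irrGF lmin z = I z ∧
      IsQuotient (I z - PowerSeries.X * PowerSeries.C z)
        (S z ^ 2) (1 + S z)) ∧
    -- all separable permutations
    IsQuotient (sepGF₂ rmax lmin z₁ z₂)
      (S z₁ * I z₂ + tz₁z₂)
      (1 - S z₁ * I z₂ - tz₁z₂) ∧
    IsQuotient (sepGF₂ lmax rmin z₁ z₂)
      (S z₁ * I z₂ + tz₁z₂)
      (1 - S z₁ * I z₂ - tz₁z₂) ∧
    -- irreducible and reducible separable permutations, the pair `(rmax, lmin)`
    IsQuotient
      (irrGF₂ rmax lmin z₁ z₂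
        + S z₁ * I z₂)
      (S z₁ * I z₂ + tz₁z₂)
      (1 - S z₁ * I z₂ - tz₁z₂) ∧
    redGF₂ rmax lmin z₁ z₂
      = S z₁ * I z₂ ∧
    -- irreducible and reducible separable permutations, the pair `(lmax, rmin)`
    irrGF₂ lmax rmin z₁ z₂
      = S z₁ * I z₂ + tz₁z₂ ∧
    IsQuotient
      (redGF₂ lmax rmin z₁ z₂
        + S z₁ * I z₂ + tz₁z₂)
      (S z₁ * I z₂ + tz₁z₂)
      (1 - S z₁ * I z₂ - tz₁z₂) := by
  -- The explicit arguments come in the order `z`, `y`, and `y` marks the first statistic, so `y` is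
  -- `z₁`.
  have hF := isQuotient_sepSeries_lmax_rmin z₂ z₁
  have hF' := hF
  rw [← sepSeries_rmax_lmin] at hF'
  refine ⟨fun z _ => ⟨(S_eq_sepSeries_lmax z).symm, rfl, ?_, ?_, hasClosedForm_S z, rfl,
    irrSeries_lmin_eq_rmax z, isQuotient_I_sub z⟩, hF', hF, ?_, redSeries_rmax_lmin z₂ z₁,
    irrSeries_lmax_rmin z₂ z₁, ?_⟩
  · rw [S_eq_sepSeries_lmax, ← sepSeries_rmin_eq_lmax]
    exact sepSeries_lmin z
  · rw [S_eq_sepSeries_lmax]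
    exact sepSeries_rmin_eq_lmax z
  · rw [sepSeries_eq_add, redSeries_rmax_lmin] at hF'
    exact hF'
  · rw [sepSeries_eq_add, irrSeries_lmax_rmin, add_comm, ← add_assoc] at hF
    exact hF
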